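/- Let $(X,\mathcal A,\mu)$ together with a group $\Sigma$ be an infinite Hamming cube, i.e. $(X,\mathcal A,\mu)$ is a non-atomic probability space and $\Sigma$ is a group of measurable bijections of $X$ such that, whenever $A_1,\dots,A_n$ and $B_1,\dots,B_n$ are measurable partitions of $X$ into sets of positive measure with $\mu(A_i)=\mu(B_i)$ for all $i$, there is $\sigma\in\Sigma$ with $\sigma(A_i)=B_i$ up to $\mu$-null sets for all $i$. For $E,F\in\mathcal A$ put $\langle E,F\rangle = 1-2\mu(E\,\Delta\,F)\in[-1,1]$, and call $f:[-1,1]\to\mathbb R$ positive definite on the cube if for all $m$ and all $E_1,\dots,E_m\in\mathcal A$ the matrix $(f(\langle E_i,E_j\rangle))_{i,j=1}^m$ is positive semidefinite. Let $f:[-1,1]\to\mathbb R$. Then $f$ is continuous and positive definite on the infinite Hamming cube if and only if there are $a_j\ge 0$ such that $$f(u)=\sum_{j=0}^\infty a_j u^j\qquad\text{for all } u\in[-1,1].$$ Moreover, for every such expansion (where $\sum_j a_j=f(1)<\infty$), the series converges to $f$ uniformly on $[-1,1]$. -/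

import Mathlib

open MeasureTheory

/-- `μ` is non-atomic: every measurable set of positive measure has a measurable subset whose
measure is positive and strictly smaller. (Mathlib's class about null singletons is a different
notion when the `σ`-algebra is not countably separated.) -/
def IsNonatomic {X : Type*} [MeasurableSpace X] (μ : Measure X) : Prop :=
  ∀ A : Set X, MeasurableSet A → 0 < μ A →
    ∃ B : Set X, B ⊆ A ∧ MeasurableSet B ∧ 0 < μ B ∧ μ B < μ A

/-- `A` is a measurable partition of `X`, indexed by `Fin n`, into parts of positive measure. -/
structure IsMeasurablePartition {X : Type*} [MeasurableSpace X] (μ : Measure X) {n : ℕ}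
    (A : Fin n → Set X) : Prop where
  measurableSet : ∀ i, MeasurableSet (A i)
  disjoint : Pairwise fun i j => Disjoint (A i) (A j)
  iUnion_eq : ⋃ i, A i = Set.univ
  measure_pos : ∀ i, 0 < μ (A i)

/-- An infinite Hamming cube: a non-atomic probability space `(X, μ)` with a group `S` of
measurable bijections of `X` (as `S` is a group, the inverses are measurable too) such that any two
finite measurable partitions whose corresponding parts have equal measures are carried to one
another by an element of `S`, up to null sets. The points of the cube are the measurable subsets
of `X`. -/
structure IsInfiniteHammingCube {X : Type*} [MeasurableSpace X] (μ : Measure X)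
    (S : Subgroup (Equiv.Perm X)) : Prop where
  isProbabilityMeasure : IsProbabilityMeasure μ
  nonatomic : IsNonatomic μ
  measurable : ∀ σ ∈ S, Measurable σ
  transitive : ∀ (n : ℕ) (A B : Fin n → Set X),
    IsMeasurablePartition μ A → IsMeasurablePartition μ B → (∀ i, μ (A i) = μ (B i)) →
      ∃ σ ∈ S, ∀ i, σ '' A i =ᵐ[μ] B i

/-- The normalized inner product of two points of the cube, `⟨E, F⟩ = 1 - 2 μ(E ∆ F) ∈ [-1, 1]`.
For unions of parts of a partition into `n` parts of measure `1 / n` this is the normalized inner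
product `1 - (2 / n) d(x, y)` of the corresponding points of `{-1, 1}ⁿ`. -/
noncomputable def hammingInner {X : Type*} [MeasurableSpace X] (μ : Measure X) (E F : Set X) : ℝ :=
  1 - 2 * μ.real (symmDiff E F)

/-- `f : [-1, 1] → ℝ` (a real function of which only the values on `[-1, 1]` matter) is positive
definite on the infinite Hamming cube: for all measurable `E 1, …, E m` the matrix
`(f ⟨E i, E j⟩)` is positive semidefinite. -/
def IsPositiveDefiniteOnCube {X : Type*} [MeasurableSpace X] (μ : Measure X) (f : ℝ → ℝ) : Prop :=
  ∀ (m : ℕ) (E : Fin m → Set X), (∀ i, MeasurableSet (E i)) →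
    (Matrix.of fun i j : Fin m => f (hammingInner μ (E i) (E j))).PosSemidef

/-!
The forward direction rests on one observation: the Bernstein polynomials of a function that is
positive definite on the cube have nonnegative coefficients in powers of `u`.

Split `X` into `n` disjoint parts of measure `1 / n`, which is possible because a non-atomic finite
measure takes all intermediate values (`IsNonatomic.exists_subset_measureReal_eq`). Unions of parts
form a copy of the group `{-1, 1}ⁿ`, realized as `Finset (Fin n)` with symmetric difference, and
positive definiteness of `f`, tested against the characters `walsh S` of this group, says that the
Fourier coefficients `∑ T, f (1 - 2 |T| / n) * walsh S T` are nonnegative. If the coordinates of a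
point of `{-1, 1}ⁿ` are independent with mean `u`, the character `walsh S` has expectation
`u ^ |S|`, so the expectation of `f` at the mean of the coordinates is a polynomial in `u` with
nonnegative coefficients. This expectation is the `n`-th Bernstein polynomial of `f` on `[-1, 1]`
(`IsPositiveDefiniteOnCube.exists_polynomial_eval_eq_bernsteinApproximation`). By Bernstein's
theorem `f` is therefore a limit of polynomials with nonnegative coefficients, and, by compactness
of the coefficient sequences and dominated convergence, such a limit is a power series with
nonnegative coefficients, first inside `(-1, 1)` and then by continuity at the endpoints
(`exists_hasSum_of_tendsto_polynomial_eval`).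

Conversely, `⟨E, F⟩` is the integral of the product of the two `±1`-valued functions attached to
`E` and `F`, so its matrices are positive semidefinite; by the Schur product theorem so are their
entrywise powers, and hence also nonnegative combinations of these and limits of such combinations.
-/

/-! ### Intermediate values of non-atomic measures -/

/-- Splitting a set in two and keeping the lighter part of positive measure, `n` times, divides the
measure by at least `2 ^ n`. -/
lemma IsNonatomic.exists_subset_measureReal_le_div_two_pow {X : Type*} [MeasurableSpace X]
    {μ : Measure X} [IsFiniteMeasure μ] (hμ : IsNonatomic μ) {A : Set X} (hA : MeasurableSet A)
    (hpos : 0 < μ.real A) (n : ℕ) :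
    ∃ B ⊆ A, MeasurableSet B ∧ 0 < μ.real B ∧ μ.real B ≤ μ.real A / 2 ^ n := by
  induction n with
  | zero => exact ⟨A, subset_rfl, hA, hpos, by simp⟩
  | succ n ih =>
    obtain ⟨B, hBA, hB, hB0, hBn⟩ := ih
    obtain ⟨C, hCB, hC, hC0, hClt⟩ := hμ B hB (ENNReal.toReal_pos_iff.1 hB0).1
    have hC0' : 0 < μ.real C := ENNReal.toReal_pos hC0.ne' (measure_ne_top μ C)
    have hClt' : μ.real C < μ.real B := ENNReal.toReal_strict_mono (measure_ne_top μ B) hClt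
    have hdiff : μ.real (B \ C) = μ.real B - μ.real C := measureReal_sdiff hCB hC
    have hpow : μ.real A / 2 ^ (n + 1) = μ.real A / 2 ^ n / 2 := by rw [pow_succ, div_div]
    rcases le_total (μ.real C) (μ.real B / 2) with h | h
    · exact ⟨C, hCB.trans hBA, hC, hC0', by linarith⟩
    · exact ⟨B \ C, Set.sdiff_subset.trans hBA, hB.diff hC, by linarith, by linarith⟩

lemma IsNonatomic.exists_subset_measureReal_pos_le {X : Type*} [MeasurableSpace X]
    {μ : Measure X} [IsFiniteMeasure μ] (hμ : IsNonatomic μ) {A : Set X} (hA : MeasurableSet A)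
    (hpos : 0 < μ.real A) {ε : ℝ} (hε : 0 < ε) :
    ∃ B ⊆ A, MeasurableSet B ∧ 0 < μ.real B ∧ μ.real B ≤ ε := by
  obtain ⟨n, hn⟩ := pow_unbounded_of_one_lt (μ.real A / ε) one_lt_two
  obtain ⟨B, hBA, hB, hB0, hBn⟩ := hμ.exists_subset_measureReal_le_div_two_pow hA hpos n
  refine ⟨B, hBA, hB, hB0, hBn.trans ?_⟩
  rw [div_lt_iff₀ hε] at hn
  rw [div_le_iff₀ (by positivity)]
  linarith

/-- Sierpiński's theorem: a finite non-atomic measure takes on the measurable subsets of `A` every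
value between `0` and the measure of `A`. The set is built greedily, each step gaining at least half
of what can still be gained below the bound `c`. -/
lemma IsNonatomic.exists_subset_measureReal_eq {X : Type*} [MeasurableSpace X]
    {μ : Measure X} [IsFiniteMeasure μ] (hμ : IsNonatomic μ) {A : Set X} (hA : MeasurableSet A)
    {c : ℝ} (hc0 : 0 ≤ c) (hcA : c ≤ μ.real A) :
    ∃ B ⊆ A, MeasurableSet B ∧ μ.real B = c := by
  let P := {B : Set X // B ⊆ A ∧ MeasurableSet B ∧ μ.real B ≤ c}
  have step (B : P) : ∃ C : P, B.1 ⊆ C.1 ∧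
      ∀ D : P, B.1 ⊆ D.1 → μ.real B.1 + μ.real D.1 ≤ 2 * μ.real C.1 := by
    let R : Set ℝ := {r | ∃ D : P, B.1 ⊆ D.1 ∧ μ.real D.1 = r}
    have hR : BddAbove R := ⟨c, by rintro _ ⟨D, -, rfl⟩; exact D.2.2.2⟩
    have hle (D : P) (hD : B.1 ⊆ D.1) : μ.real D.1 ≤ sSup R := le_csSup hR ⟨D, hD, rfl⟩
    rcases (hle B subset_rfl).eq_or_lt with h | h
    · refine ⟨B, subset_rfl, fun D hD => ?_⟩
      linarith [hle D hD]
    · obtain ⟨_, ⟨C, hBC, rfl⟩, hC⟩ :=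
        exists_lt_of_lt_csSup (s := R) ⟨_, B, subset_rfl, rfl⟩ (add_div_two_lt_right.2 h)
      refine ⟨C, hBC, fun D hD => ?_⟩
      linarith [hle D hD]
  choose next hsub hnext using step
  let B : ℕ → P := fun n => next^[n] ⟨∅, Set.empty_subset _, MeasurableSet.empty, by simpa⟩
  have hB (n : ℕ) : B (n + 1) = next (B n) := Function.iterate_succ_apply' _ _ _
  have hmono : Monotone fun n => (B n).1 :=
    monotone_nat_of_le_succ fun n => by simpa only [hB] using! hsub (B n)
  let U := ⋃ n, (B n).1
  have hU : MeasurableSet U := MeasurableSet.iUnion fun n => (B n).2.2.1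
  have hUA : U ⊆ A := Set.iUnion_subset fun n => (B n).2.1
  have htend : Filter.Tendsto (fun n => μ.real (B n).1) Filter.atTop (nhds (μ.real U)) :=
    (ENNReal.tendsto_toReal (measure_ne_top μ U)).comp (tendsto_measure_iUnion_atTop hmono)
  have hUc : μ.real U ≤ c := le_of_tendsto' htend fun n => (B n).2.2.2
  refine ⟨U, hUA, hU, hUc.eq_of_not_lt fun hlt => ?_⟩
  have hdiff : μ.real (A \ U) = μ.real A - μ.real U := measureReal_sdiff hUA hU
  obtain ⟨D, hDA, hD, hD0, hDc⟩ := hμ.exists_subset_measureReal_pos_le (hA.diff hU)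
    (by linarith) (sub_pos.2 hlt)
  have hUD : μ.real (U ∪ D) = μ.real U + μ.real D :=
    measureReal_union (Set.disjoint_of_subset_right hDA Set.disjoint_sdiff_right) hD
  let V : P := ⟨U ∪ D, Set.union_subset hUA (hDA.trans Set.sdiff_subset), hU.union hD, by linarith⟩
  have hgain (n : ℕ) : μ.real (B n).1 + μ.real V.1 ≤ 2 * μ.real (B (n + 1)).1 := by
    rw [hB]
    exact hnext (B n) V ((Set.subset_iUnion (fun n => (B n).1) n).trans Set.subset_union_left)
  have hlim := le_of_tendsto_of_tendsto' (htend.add_const (μ.real V.1))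
    ((htend.comp (Filter.tendsto_add_atTop_nat 1)).const_mul 2) hgain
  have : μ.real V.1 = μ.real U + μ.real D := hUD
  linarith

lemma IsNonatomic.exists_pairwise_disjoint_measureReal_eq {X : Type*} [MeasurableSpace X]
    {μ : Measure X} [IsFiniteMeasure μ] (hμ : IsNonatomic μ) {c : ℝ} (hc : 0 ≤ c) (n : ℕ)
    {A : Set X} (hA : MeasurableSet A) (hcA : n * c ≤ μ.real A) :
    ∃ B : Fin n → Set X, (∀ i, B i ⊆ A) ∧ (∀ i, MeasurableSet (B i)) ∧
      (Pairwise fun i j => Disjoint (B i) (B j)) ∧ ∀ i, μ.real (B i) = c := by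
  induction n generalizing A with
  | zero => exact ⟨fun _ => ∅, by simp, by simp, fun i => i.elim0, fun i => i.elim0⟩
  | succ n ih =>
    have hnc : 0 ≤ n * c := by positivity
    push_cast at hcA
    obtain ⟨C, hCA, hC, hCc⟩ := hμ.exists_subset_measureReal_eq hA hc (by linarith)
    have hdiff : μ.real (A \ C) = μ.real A - μ.real C := measureReal_sdiff hCA hC
    obtain ⟨B, hBA, hB, hdisj, hBc⟩ := ih (hA.diff hC) (by linarith)
    have hCB (i : Fin n) : Disjoint C (B i) :=
      Set.disjoint_of_subset_right (hBA i) Set.disjoint_sdiff_right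
    refine ⟨Fin.cons C B, ?_, ?_, ?_, ?_⟩
    · exact Fin.forall_fin_succ.2 ⟨hCA, fun i => (hBA i).trans Set.sdiff_subset⟩
    · exact Fin.forall_fin_succ.2 ⟨hC, hB⟩
    · intro i j hij
      induction i using Fin.cases <;> induction j using Fin.cases
      · exact absurd rfl hij
      · exact hCB _
      · exact (hCB _).symm
      · exact hdisj fun h => hij (congrArg _ h)
    · exact Fin.forall_fin_succ.2 ⟨hCc, hBc⟩

/-! ### Finite cubes inside the infinite cube -/

lemma symmDiff_biUnion_finset_of_pairwise_disjoint {X ι : Type*} [DecidableEq ι] {A : ι → Set X}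
    (hA : Pairwise fun i j => Disjoint (A i) (A j)) (S T : Finset ι) :
    symmDiff (⋃ i ∈ S, A i) (⋃ i ∈ T, A i) = ⋃ i ∈ symmDiff S T, A i := by
  have huniq {x : X} {i j : ι} (hi : x ∈ A i) (hj : x ∈ A j) : i = j := by
    by_contra h
    exact Set.disjoint_left.1 (hA h) hi hj
  have hmem {x : X} {i : ι} (hi : x ∈ A i) (S : Finset ι) : x ∈ (⋃ i ∈ S, A i) ↔ i ∈ S := by
    simp only [Set.mem_iUnion, exists_prop]
    exact ⟨fun ⟨j, hj, hx⟩ => huniq hi hx ▸ hj, fun h => ⟨i, h, hi⟩⟩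
  ext x
  by_cases h : ∃ i, x ∈ A i
  · obtain ⟨i, hi⟩ := h
    rw [Set.mem_symmDiff, hmem hi, hmem hi, hmem hi, Finset.mem_symmDiff]
  · push Not at h
    simp [Set.mem_symmDiff, h]

/-- In the finite cube spanned by `n` disjoint sets of measure `1 / n`, the inner product of the
points `S` and `T` is a function of the cardinality of their symmetric difference. -/
lemma hammingInner_biUnion {X : Type*} [MeasurableSpace X] {μ : Measure X} [IsFiniteMeasure μ]
    {n : ℕ} {A : Fin n → Set X} (hA : ∀ i, MeasurableSet (A i))
    (hdisj : Pairwise fun i j => Disjoint (A i) (A j)) (hμA : ∀ i, μ.real (A i) = 1 / n)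
    (S T : Finset (Fin n)) :
    hammingInner μ (⋃ i ∈ S, A i) (⋃ i ∈ T, A i) = 1 - 2 * ((symmDiff S T).card / n) := by
  rw [hammingInner, symmDiff_biUnion_finset_of_pairwise_disjoint hdisj,
    measureReal_biUnion_finset (fun i _ j _ hij => hdisj hij) (fun i _ => hA i)]
  simp [hμA, div_eq_mul_inv]

lemma IsPositiveDefiniteOnCube.posSemidef {X : Type*} [MeasurableSpace X] {μ : Measure X}
    {f : ℝ → ℝ} (hf : IsPositiveDefiniteOnCube μ f) {ι : Type*} [Fintype ι] {E : ι → Set X}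
    (hE : ∀ i, MeasurableSet (E i)) :
    (Matrix.of fun i j => f (hammingInner μ (E i) (E j))).PosSemidef := by
  let e := Fintype.equivFin ι
  simpa [Matrix.submatrix, Function.comp_def] using!
    (hf _ (fun k => E (e.symm k)) fun k => hE _).submatrix e

/-! ### Characters of the finite cube -/

/-- The Walsh function `T ↦ (-1) ^ |S ∩ T|`, a character of the group of finite sets under symmetric
difference. -/
def walsh {ι : Type*} [DecidableEq ι] (S T : Finset ι) : ℝ :=
  ∏ i ∈ S, if i ∈ T then -1 else 1

lemma walsh_symmDiff {ι : Type*} [DecidableEq ι] (S T U : Finset ι) :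
    walsh S (symmDiff T U) = walsh S T * walsh S U := by
  simp only [walsh, ← Finset.prod_mul_distrib]
  refine Finset.prod_congr rfl fun i _ => ?_
  by_cases hT : i ∈ T <;> by_cases hU : i ∈ U <;> simp [Finset.mem_symmDiff, hT, hU]

/-- A positive definite function on the group of finite subsets of `ι` has nonnegative Fourier
coefficients. -/
lemma sum_mul_walsh_nonneg {ι : Type*} [Fintype ι] [DecidableEq ι] {g : Finset ι → ℝ}
    (hg : (Matrix.of fun S T => g (symmDiff S T)).PosSemidef) (S : Finset ι) :
    0 ≤ ∑ T, g T * walsh S T := by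
  have h := hg.dotProduct_mulVec_nonneg (walsh S)
  have key : star (walsh S) ⬝ᵥ ((Matrix.of fun S T => g (symmDiff S T)).mulVec (walsh S)) =
      Fintype.card (Finset ι) * ∑ T, g T * walsh S T := by
    simp only [dotProduct, Matrix.mulVec, Pi.star_apply, star_trivial, Matrix.of_apply]
    rw [← nsmul_eq_mul, ← Finset.card_univ, ← Finset.sum_const]
    refine Finset.sum_congr rfl fun T _ => ?_
    rw [Finset.mul_sum]
    refine Fintype.sum_equiv (symmDiff_right_involutive T).toPerm _ _ fun U => ?_
    simp only [Function.Involutive.coe_toPerm, walsh_symmDiff]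
    ring
  rw [key] at h
  exact nonneg_of_mul_nonneg_right h (by positivity)

/-- The probability of the point `T` of the cube, when coordinates are independent with mean `u`,
expanded in characters. -/
lemma pow_mul_pow_eq_sum_walsh {n : ℕ} (T : Finset (Fin n)) (u : ℝ) :
    ((1 - u) / 2) ^ T.card * ((1 + u) / 2) ^ (n - T.card) =
      ∑ S, (1 / 2) ^ n * walsh S T * u ^ S.card := by
  have hprod : ((1 - u) / 2) ^ T.card * ((1 + u) / 2) ^ (n - T.card) =
      ∏ i : Fin n, (1 / 2) * (1 + (if i ∈ T then -1 else 1) * u) := by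
    rw [← Finset.prod_mul_prod_compl T, Finset.prod_congr rfl (g := fun _ => (1 - u) / 2),
      Finset.prod_congr (s₁ := Tᶜ) rfl (g := fun _ => (1 + u) / 2)]
    · simp only [Finset.prod_const, Finset.card_compl, Fintype.card_fin]
    · intro i hi
      rw [if_neg (Finset.mem_compl.1 hi)]
      ring
    · intro i hi
      rw [if_pos hi]
      ring
  rw [hprod, Finset.prod_mul_distrib, Finset.prod_one_add, Finset.mul_sum, Finset.powerset_univ]
  refine Finset.sum_congr rfl fun S _ => ?_
  simp only [walsh, Finset.prod_mul_distrib, Finset.prod_const, Finset.card_univ, Fintype.card_fin,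
    mul_assoc]

/-! ### Bernstein polynomials -/

/-- The Bernstein polynomials on `[-1, 1]` of a positive definite function on the cube have
nonnegative coefficients. The interval `[-1, 1]` is parametrized by `x ↦ 1 - 2 * x`, where `x` is
the measure of a symmetric difference. -/
lemma IsPositiveDefiniteOnCube.exists_polynomial_eval_eq_bernsteinApproximation {X : Type*}
    [MeasurableSpace X] {μ : Measure X} [IsProbabilityMeasure μ] (hμ : IsNonatomic μ) {f : ℝ → ℝ}
    (hf : IsPositiveDefiniteOnCube μ f) {F : C(unitInterval, ℝ)} (hF : ∀ x, F x = f (1 - 2 * x))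
    {n : ℕ} (hn : n ≠ 0) :
    ∃ p : Polynomial ℝ, (∀ k, 0 ≤ p.coeff k) ∧
      ∀ x : unitInterval, p.eval (1 - 2 * (x : ℝ)) = bernsteinApproximation n F x := by
  obtain ⟨A, -, hA, hdisj, hμA⟩ := hμ.exists_pairwise_disjoint_measureReal_eq
    (c := 1 / n) (by positivity) n MeasurableSet.univ (by simp [hn])
  let g : Finset (Fin n) → ℝ := fun T => f (1 - 2 * (T.card / n))
  have hg : (Matrix.of fun S T => g (symmDiff S T)).PosSemidef := by
    have h := hf.posSemidef (E := fun T : Finset (Fin n) => ⋃ i ∈ T, A i)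
      fun T => Finset.measurableSet_biUnion T fun i _ => hA i
    simpa only [hammingInner_biUnion hA hdisj hμA] using h
  refine ⟨∑ S, Polynomial.monomial S.card ((1 / 2) ^ n * ∑ T, g T * walsh S T), fun k => ?_,
    fun x => ?_⟩
  · rw [Polynomial.finsetSum_coeff]
    refine Finset.sum_nonneg fun S _ => ?_
    rw [Polynomial.coeff_monomial]
    split_ifs
    · exact mul_nonneg (by positivity) (sum_mul_walsh_nonneg hg S)
    · exact le_rfl
  · calc
      _ = ∑ S, ∑ T, g T * ((1 / 2) ^ n * walsh S T * (1 - 2 * (x : ℝ)) ^ S.card) := by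
        simp only [Polynomial.eval_finsetSum, Polynomial.eval_monomial, Finset.mul_sum,
          Finset.sum_mul]
        exact Finset.sum_congr rfl fun S _ => Finset.sum_congr rfl fun T _ => by ring
      _ = ∑ T, g T * ((x : ℝ) ^ T.card * (1 - (x : ℝ)) ^ (n - T.card)) := by
        rw [Finset.sum_comm]
        refine Finset.sum_congr rfl fun T _ => ?_
        rw [← Finset.mul_sum, ← pow_mul_pow_eq_sum_walsh]
        ring_nf
      _ = ∑ k ∈ Finset.range (n + 1), n.choose k •
            (f (1 - 2 * (k / n)) * ((x : ℝ) ^ k * (1 - (x : ℝ)) ^ (n - k))) := by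
        rw [← Finset.powerset_univ, Finset.sum_powerset_apply_card
          fun k => f (1 - 2 * (k / n)) * ((x : ℝ) ^ k * (1 - (x : ℝ)) ^ (n - k))]
        simp
      _ = _ := by
        rw [Finset.sum_range, bernsteinApproximation.apply]
        refine Finset.sum_congr rfl fun k _ => ?_
        rw [bernstein_apply, hF, nsmul_eq_mul, smul_eq_mul, bernstein.z]
        ring

/-! ### Power series with nonnegative coefficients -/

lemma norm_mul_pow_le_of_mem_Icc {a : ℝ} (ha : 0 ≤ a) {u : ℝ} (hu : u ∈ Set.Icc (-1 : ℝ) 1)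
    (k : ℕ) : ‖a * u ^ k‖ ≤ a := by
  rw [norm_mul, norm_pow, Real.norm_of_nonneg ha]
  exact mul_le_of_le_one_right ha (pow_le_one₀ (norm_nonneg u) (abs_le.2 hu))

/-- On `[-1, 1]`, pointwise limits of polynomials with nonnegative coefficients are, as soon as they
are continuous, power series with nonnegative coefficients. -/
lemma exists_hasSum_of_tendsto_polynomial_eval {f : ℝ → ℝ}
    (hf : ContinuousOn f (Set.Icc (-1) 1)) {p : ℕ → Polynomial ℝ} (hp : ∀ n k, 0 ≤ (p n).coeff k)
    (hlim : ∀ u ∈ Set.Icc (-1 : ℝ) 1,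
      Filter.Tendsto (fun n => (p n).eval u) Filter.atTop (nhds (f u))) :
    ∃ a : ℕ → ℝ, (∀ j, 0 ≤ a j) ∧
      ∀ u ∈ Set.Icc (-1 : ℝ) 1, HasSum (fun j => a j * u ^ j) (f u) := by
  have heval (n : ℕ) (u : ℝ) : HasSum (fun k => (p n).coeff k * u ^ k) ((p n).eval u) := by
    rw [Polynomial.eval_eq_sum, Polynomial.sum]
    exact hasSum_sum_of_ne_finset_zero fun k hk => by
      rw [Polynomial.notMem_support_iff.1 hk, zero_mul]
  have hone : (1 : ℝ) ∈ Set.Icc (-1 : ℝ) 1 := by norm_num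
  have hpart (n : ℕ) (s : Finset ℕ) : ∑ k ∈ s, (p n).coeff k ≤ (p n).eval 1 := by
    simpa using sum_le_hasSum s (fun k _ => by simpa using hp n k) (heval n 1)
  obtain ⟨M, hM⟩ := (hlim 1 hone).bddAbove_range
  have hcoeff (n k : ℕ) : (p n).coeff k ∈ Set.Icc 0 M :=
    ⟨hp n k, by simpa using (hpart n {k}).trans (hM (Set.mem_range_self n))⟩
  -- An ultrafilter replaces the diagonal extraction of a subsequence along which all coefficients
  -- converge.
  let l : Ultrafilter ℕ := Ultrafilter.of Filter.atTop
  have hl : (l : Filter ℕ) ≤ Filter.atTop := Ultrafilter.of_le _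
  have hconv (k : ℕ) : ∃ b ∈ Set.Icc 0 M, Filter.Tendsto (fun n => (p n).coeff k) l (nhds b) :=
    isCompact_Icc.ultrafilter_le_nhds (l.map fun n : ℕ => (p n).coeff k)
      (Filter.tendsto_principal.2 (.of_forall fun n => hcoeff n k))
  choose a ha hal using hconv
  have hasum : Summable a := by
    refine summable_of_sum_le (fun k => (ha k).1) (c := f 1) fun s => ?_
    exact le_of_tendsto_of_tendsto' (tendsto_finsetSum s fun k _ => hal k)
      ((hlim 1 hone).mono_left hl) fun n => hpart n s
  have hsummable {u : ℝ} (hu : u ∈ Set.Icc (-1 : ℝ) 1) : Summable fun k => a k * u ^ k :=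
    hasum.of_norm_bounded fun k => norm_mul_pow_le_of_mem_Icc (ha k).1 hu k
  have hinner : Set.EqOn (fun u => ∑' k, a k * u ^ k) f (Set.Ioo (-1) 1) := fun u hu => by
    have habs : |u| < 1 := abs_lt.2 hu
    have hdom : Filter.Tendsto (fun n => ∑' k, (p n).coeff k * u ^ k) l
        (nhds (∑' k, a k * u ^ k)) := by
      refine tendsto_tsum_of_dominated_convergence (bound := fun k => M * |u| ^ k)
        ((summable_geometric_of_lt_one (abs_nonneg u) habs).mul_left M)
        (fun k => (hal k).mul_const _) (Filter.Eventually.of_forall fun n k => ?_)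
      rw [norm_mul, norm_pow, Real.norm_of_nonneg (hp n k), Real.norm_eq_abs]
      exact mul_le_mul_of_nonneg_right (hcoeff n k).2 (by positivity)
    simp only [fun n => (heval n u).tsum_eq] at hdom
    exact tendsto_nhds_unique hdom ((hlim u (Set.Ioo_subset_Icc_self hu)).mono_left hl)
  have hcont : ContinuousOn (fun u : ℝ => ∑' k, a k * u ^ k) (Set.Icc (-1) 1) :=
    continuousOn_tsum (fun k => by fun_prop) hasum
      fun k u hu => norm_mul_pow_le_of_mem_Icc (ha k).1 hu k
  have heq := hinner.of_subset_closure hcont hf Set.Ioo_subset_Icc_self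
    (closure_Ioo (by norm_num : (-1 : ℝ) ≠ 1)).ge
  exact ⟨a, fun k => (ha k).1, fun u hu => heq hu ▸ (hsummable hu).hasSum⟩

/-! ### Positive definiteness of power series -/

lemma hammingInner_mem_Icc {X : Type*} [MeasurableSpace X] (μ : Measure X) [IsProbabilityMeasure μ]
    (E F : Set X) : hammingInner μ E F ∈ Set.Icc (-1 : ℝ) 1 := by
  have h0 : 0 ≤ μ.real (symmDiff E F) := measureReal_nonneg
  have h1 : μ.real (symmDiff E F) ≤ 1 := measureReal_le_one
  constructor <;> rw [hammingInner] <;> linarith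

/-- `⟨E, F⟩` is an inner product in `L²` of `±1`-valued functions. -/
lemma hammingInner_eq_integral {X : Type*} [MeasurableSpace X] (μ : Measure X)
    [IsProbabilityMeasure μ] {E F : Set X} (hE : MeasurableSet E) (hF : MeasurableSet F) :
    hammingInner μ E F =
      ∫ x, (1 - 2 * E.indicator 1 x) * (1 - 2 * F.indicator 1 x) ∂μ := by
  have h (x : X) : (1 - 2 * E.indicator 1 x) * (1 - 2 * F.indicator 1 x) =
      1 - 2 * (symmDiff E F).indicator (1 : X → ℝ) x := by
    by_cases h1 : x ∈ E <;> by_cases h2 : x ∈ F <;>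
      norm_num [Set.mem_symmDiff, h1, h2]
  have hint : Integrable ((symmDiff E F).indicator (1 : X → ℝ)) μ :=
    (integrable_const 1).indicator (hE.symmDiff hF)
  simp only [h]
  rw [integral_sub (integrable_const 1) (hint.const_mul 2), integral_const_mul,
    integral_indicator_one (hE.symmDiff hF)]
  simp [hammingInner]

lemma posSemidef_hammingInner {X : Type*} [MeasurableSpace X] (μ : Measure X)
    [IsProbabilityMeasure μ] {ι : Type*} [Fintype ι] {E : ι → Set X}
    (hE : ∀ i, MeasurableSet (E i)) :
    (Matrix.of fun i j => hammingInner μ (E i) (E j)).PosSemidef := by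
  refine .of_dotProduct_mulVec_nonneg ?_ fun v => ?_
  · ext i j
    simp [hammingInner, symmDiff_comm]
  let s : ι → X → ℝ := fun i x => 1 - 2 * (E i).indicator 1 x
  have hs (i j : ι) : Integrable (fun x => s i x * s j x) μ := by
    have hmeas (i : ι) : Measurable (s i) :=
      measurable_const.sub ((measurable_one.indicator (hE i)).const_mul 2)
    have hbound (i : ι) (x : X) : ‖s i x‖ ≤ 1 := by
      by_cases h : x ∈ E i <;> norm_num [s, h]
    refine .of_bound ((hmeas i).mul (hmeas j)).aestronglyMeasurable 1 (.of_forall fun x => ?_)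
    rw [norm_mul]
    exact mul_le_one₀ (hbound i x) (norm_nonneg _) (hbound j x)
  have key : star v ⬝ᵥ ((Matrix.of fun i j => hammingInner μ (E i) (E j)).mulVec v) =
      ∫ x, (∑ i, v i * s i x) ^ 2 ∂μ := by
    have hexp (x : X) : (∑ i, v i * s i x) ^ 2 = ∑ i, ∑ j, v i * v j * (s i x * s j x) := by
      rw [sq, Finset.sum_mul_sum]
      exact Finset.sum_congr rfl fun i _ => Finset.sum_congr rfl fun j _ => by ring
    simp only [hexp]
    rw [integral_finsetSum _ fun i _ => integrable_finsetSum _ fun j _ => (hs i j).const_mul _]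
    simp only [dotProduct, Matrix.mulVec, Pi.star_apply, star_trivial, Matrix.of_apply]
    refine Finset.sum_congr rfl fun i _ => ?_
    rw [integral_finsetSum _ fun j _ => (hs i j).const_mul _, Finset.mul_sum]
    refine Finset.sum_congr rfl fun j _ => ?_
    rw [integral_const_mul, hammingInner_eq_integral μ (hE i) (hE j)]
    ring
  rw [key]
  exact integral_nonneg fun x => sq_nonneg _

/-- Entrywise powers of positive semidefinite matrices are positive semidefinite, by the Schur
product theorem. -/
lemma Matrix.PosSemidef.map_pow {ι : Type*} [Fintype ι] {A : Matrix ι ι ℝ} (hA : A.PosSemidef)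
    (k : ℕ) : (A.map (· ^ k)).PosSemidef := by
  classical
  induction k with
  | zero =>
    have h := Matrix.posSemidef_vecMulVec_self_star (fun _ : ι => (1 : ℝ))
    convert h using 1
    ext i j
    simp [Matrix.vecMulVec_apply]
  | succ k ih =>
    have h := ih.hadamard hA
    have heq : (A.map (· ^ k)).hadamard A = A.map (· ^ (k + 1)) := by
      ext i j
      simp [pow_succ]
    rwa [heq] at h

lemma isPositiveDefiniteOnCube_of_hasSum {X : Type*} [MeasurableSpace X] (μ : Measure X)
    [IsProbabilityMeasure μ] {f : ℝ → ℝ} {a : ℕ → ℝ} (ha : ∀ j, 0 ≤ a j)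
    (hf : ∀ u ∈ Set.Icc (-1 : ℝ) 1, HasSum (fun j => a j * u ^ j) (f u)) :
    IsPositiveDefiniteOnCube μ f := by
  intro m E hE
  refine .of_dotProduct_mulVec_nonneg ?_ fun v => ?_
  · ext i j
    simp [hammingInner, symmDiff_comm]
  have hpow (k : ℕ) := ((posSemidef_hammingInner μ hE).map_pow k).dotProduct_mulVec_nonneg v
  simp only [dotProduct, Matrix.mulVec, Pi.star_apply, star_trivial, Matrix.of_apply,
    Matrix.map_apply] at hpow ⊢
  have hsum := hasSum_sum (s := Finset.univ) fun i _ =>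
    (hasSum_sum (s := Finset.univ) fun j _ =>
      (hf _ (hammingInner_mem_Icc μ (E i) (E j))).mul_right (v j)).mul_left (v i)
  refine hsum.nonneg fun k => ?_
  convert mul_nonneg (ha k) (hpow k) using 1
  simp only [Finset.mul_sum]
  exact Finset.sum_congr rfl fun i _ => Finset.sum_congr rfl fun j _ => by ring

/-! ### Characterization of the positive definite functions -/

theorem mainTheorem9 {X : Type*} [MeasurableSpace X] (μ : Measure X)
    (S : Subgroup (Equiv.Perm X)) (hX : IsInfiniteHammingCube μ S) (f : ℝ → ℝ) :
    ((ContinuousOn f (Set.Icc (-1) 1) ∧ IsPositiveDefiniteOnCube μ f) ↔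
      ∃ a : ℕ → ℝ, (∀ j, 0 ≤ a j) ∧
        ∀ u ∈ Set.Icc (-1 : ℝ) 1, HasSum (fun j => a j * u ^ j) (f u)) ∧
    (∀ a : ℕ → ℝ, (∀ j, 0 ≤ a j) →
      (∀ u ∈ Set.Icc (-1 : ℝ) 1, HasSum (fun j => a j * u ^ j) (f u)) →
        TendstoUniformlyOn (fun (N : ℕ) (u : ℝ) => ∑ j ∈ Finset.range N, a j * u ^ j) f
          Filter.atTop (Set.Icc (-1) 1)) := by
  have := hX.isProbabilityMeasure
  have hsummable (a : ℕ → ℝ)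
      (hf : ∀ u ∈ Set.Icc (-1 : ℝ) 1, HasSum (fun j => a j * u ^ j) (f u)) : Summable a := by
    simpa using (hf 1 (by norm_num)).summable
  have huniform (a : ℕ → ℝ) (ha : ∀ j, 0 ≤ a j)
      (hf : ∀ u ∈ Set.Icc (-1 : ℝ) 1, HasSum (fun j => a j * u ^ j) (f u)) :
      TendstoUniformlyOn (fun (N : ℕ) (u : ℝ) => ∑ j ∈ Finset.range N, a j * u ^ j) f
        Filter.atTop (Set.Icc (-1) 1) :=
    (tendstoUniformlyOn_tsum_nat (hsummable a hf)
      fun j u hu => norm_mul_pow_le_of_mem_Icc (ha j) hu j).congr_right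
        fun u hu => (hf u hu).tsum_eq
  refine ⟨⟨fun ⟨hcont, hpd⟩ => ?_, fun ⟨a, ha, hf⟩ => ⟨?_, ?_⟩⟩, huniform⟩
  · have hmaps (x : unitInterval) : 1 - 2 * (x : ℝ) ∈ Set.Icc (-1 : ℝ) 1 :=
      ⟨by linarith [x.2.2], by linarith [x.2.1]⟩
    let F : C(unitInterval, ℝ) :=
      ⟨fun x => f (1 - 2 * x), hcont.comp_continuous (by fun_prop) hmaps⟩
    -- The index is shifted by one because there are no parts of measure `1 / n` for `n = 0`.
    choose p hp hpF using fun n : ℕ => hpd.exists_polynomial_eval_eq_bernsteinApproximation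
      hX.nonatomic (F := F) (fun _ => rfl) n.succ_ne_zero
    refine exists_hasSum_of_tendsto_polynomial_eval hcont hp fun u hu => ?_
    let x : unitInterval := ⟨(1 - u) / 2, by linarith [hu.2], by linarith [hu.1]⟩
    have hx : 1 - 2 * (x : ℝ) = u := by simp only [x]; ring
    have hB := (((ContinuousEvalConst.continuous_eval_const x).tendsto F).comp
      (bernsteinApproximation_uniform F)).comp (Filter.tendsto_add_atTop_nat 1)
    have hFx : F x = f u := congrArg f hx
    rw [hFx] at hB
    exact hB.congr fun n => by rw [← hx, hpF]; rfl
  · exact (huniform a ha hf).continuousOn (Filter.Frequently.of_forall fun N => by fun_prop)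
  · exact isPositiveDefiniteOnCube_of_hasSum μ ha hf
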